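/- Let $\Gamma\subset \mathrm{GL}(3,\mathbb Z)$ be the discrete Heisenberg group of upper triangular integer matrices with ones on the diagonal. A Cantor action $(X,\Gamma,\Phi)$ is a minimal, equicontinuous action $\Phi:\Gamma\to\mathrm{Homeo}(X)$ on a Cantor space $X$ (a non-empty compact metrizable totally disconnected space without isolated points); it is nilpotent if $\Gamma$ has a finitely generated nilpotent subgroup of finite index. A non-empty clopen set $U\subset X$ is adapted if for every $g\in\Gamma$, $\Phi(g)(U)\cap U\neq\emptyset$ implies $\Phi(g)(U)=U$; then $\Gamma_U=\{g\in\Gamma : \Phi(g)(U)\cap U\ne\emptyset\}$ is a subgroup, and $\mathcal H_U\subset\mathrm{Homeo}(U)$ denotes the image of $\Gamma_U$ under restriction to $U$. Two actions $(X_i,\Gamma_i,\Phi_i)$, $i=1,2$, are isomorphic if there are a homeomorphism $h:X_1\to X_2$ and a group isomorphism $\Theta:\Gamma_1\to\Gamma_2$ with $\Phi_1(g)=h^{-1}\circ\Phi_2(\Theta(g))\circ h$ for all $g\in\Gamma_1$; they are conjugate if $\Gamma_1=\Gamma_2$ and this holds with $\Theta=\mathrm{id}$. Two Cantor actions are return equivalent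 if there are adapted sets $U_1\subset X_1$, $U_2\subset X_2$ such that the actions of $\mathcal H_{1,U_1}$ on $U_1$ and of $\mathcal H_{2,U_2}$ on $U_2$ are isomorphic. There exists an uncountable set of nilpotent Cantor actions of the Heisenberg group $\Gamma$ that are pairwise not return equivalent, and hence pairwise not isomorphic and not conjugate. -/

import Mathlib

/-- The discrete Heisenberg group: the subgroup of `GL(3, ℤ)` of all upper triangular integer
matrices with ones on the diagonal. -/
def heisenbergGroup : Subgroup (Matrix.GeneralLinearGroup (Fin 3) ℤ) where
  carrier := {g | ∃ a b c : ℤ, (g : Matrix (Fin 3) (Fin 3) ℤ) = !![1, a, c; 0, 1, b; 0, 0, 1]}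
  one_mem' := ⟨0, 0, 0, by
    ext i j
    fin_cases i <;> fin_cases j <;> simp⟩
  mul_mem' := by
    rintro g g' ⟨a, b, c, h⟩ ⟨a', b', c', h'⟩
    refine ⟨a' + a, b' + b, c' + a * b' + c, ?_⟩
    rw [Units.val_mul, h, h']
    ext i j
    fin_cases i <;> fin_cases j <;> simp [Matrix.mul_apply, Fin.sum_univ_three]
  inv_mem' := by
    rintro g ⟨a, b, c, h⟩
    refine ⟨-a, -b, a * b - c, ?_⟩
    apply Units.inv_eq_of_mul_eq_one_right
    rw [h]
    ext i j
    fin_cases i <;> fin_cases j <;> simp [Matrix.mul_apply, Fin.sum_univ_three]; ring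

namespace CantorDynamics

/-- A Cantor space: a non-empty compact metrizable totally disconnected space without isolated
points. -/
class IsCantorSpace (X : Type*) [TopologicalSpace X] : Prop where
  nonempty : Nonempty X
  compact : CompactSpace X
  metrizable : TopologicalSpace.MetrizableSpace X
  totallyDisconnected : TotallyDisconnectedSpace X
  perfect : PerfectSpace X

section Action

variable {X : Type*} [TopologicalSpace X] {Γ : Type*} [Group Γ]

/-- An action by homeomorphisms is minimal if every orbit is dense. -/
def IsMinimal (Φ : Γ →* (X ≃ₜ X)) : Prop :=
  ∀ x : X, Dense (Set.range fun g : Γ => Φ g x)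

/-- An action by homeomorphisms is equicontinuous if it is so for a metric that induces the
topology of `X` (on a compact space, the choice of this metric does not matter). -/
def IsEquicontinuous (Φ : Γ →* (X ≃ₜ X)) : Prop :=
  ∃ m : MetricSpace X,
    m.toPseudoMetricSpace.toUniformSpace.toTopologicalSpace = ‹TopologicalSpace X› ∧
    ∀ ε : ℝ, 0 < ε → ∃ δ : ℝ, 0 < δ ∧ ∀ (x y : X) (g : Γ),
      m.dist x y < δ → m.dist (Φ g x) (Φ g y) < ε

/-- A set is adapted to an action if it is non-empty and clopen, and each of its translates is
either equal to it or disjoint from it. -/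
structure IsAdapted (Φ : Γ →* (X ≃ₜ X)) (U : Set X) : Prop where
  nonempty : U.Nonempty
  isClopen : IsClopen U
  eq_of_inter : ∀ g : Γ, ((Φ g '' U) ∩ U).Nonempty → Φ g '' U = U

/-- The group `Γ_U` of return times to an adapted set `U`. -/
def returnGroup (Φ : Γ →* (X ≃ₜ X)) (U : Set X) (hU : IsAdapted Φ U) : Subgroup Γ where
  carrier := {g | ((Φ g '' U) ∩ U).Nonempty}
  one_mem' := by
    have h : Φ 1 '' U = U := by
      rw [map_one]
      exact Set.image_id U
    rw [Set.mem_ofPred_eq, h, Set.inter_self]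
    exact hU.nonempty
  mul_mem' := by
    intro g g' hg hg'
    have h : Φ (g * g') '' U = U := by
      have : (Φ (g * g') : X → X) = Φ g ∘ Φ g' := by rw [map_mul]; rfl
      rw [this, Set.image_comp, hU.eq_of_inter g' hg', hU.eq_of_inter g hg]
    rw [Set.mem_ofPred_eq, h, Set.inter_self]
    exact hU.nonempty
  inv_mem' := by
    intro g hg
    have h : Φ g⁻¹ '' U = U := by
      conv_lhs => rw [← hU.eq_of_inter g hg]
      rw [← Set.image_comp]
      have : (Φ g⁻¹ : X → X) ∘ Φ g = id := by
        funext x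
        rw [map_inv]
        exact (Φ g).symm_apply_apply x
      rw [this, Set.image_id]
    rw [Set.mem_ofPred_eq, h, Set.inter_self]
    exact hU.nonempty

theorem image_eq_of_mem_returnGroup {Φ : Γ →* (X ≃ₜ X)} {U : Set X} {hU : IsAdapted Φ U}
    (g : returnGroup Φ U hU) : Φ g '' U = U :=
  hU.eq_of_inter g g.2

/-- The restricted action of `Γ_U` on an adapted set `U`. -/
def restrictedAction (Φ : Γ →* (X ≃ₜ X)) (U : Set X) (hU : IsAdapted Φ U) :
    returnGroup Φ U hU →* (U ≃ₜ U) where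
  toFun g := (Φ g).sets (by
    have h := (Φ (g : Γ)).injective.preimage_image U
    rw [image_eq_of_mem_returnGroup] at h
    exact h.symm)
  map_one' := by
    ext x
    simp [Homeomorph.sets]
  map_mul' g g' := by
    ext x
    simp [Homeomorph.sets]

/-- The holonomy group `H_U`: the image of `Γ_U` in the homeomorphism group of `U`. -/
def holonomyGroup (Φ : Γ →* (X ≃ₜ X)) (U : Set X) (hU : IsAdapted Φ U) : Subgroup (U ≃ₜ U) :=
  (restrictedAction Φ U hU).range

/-- The holonomy action: the tautological action of `H_U` on `U`. -/
def holonomyAction (Φ : Γ →* (X ≃ₜ X)) (U : Set X) (hU : IsAdapted Φ U) :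
    holonomyGroup Φ U hU →* (U ≃ₜ U) :=
  (holonomyGroup Φ U hU).subtype

end Action

/-- Two actions are isomorphic if a homeomorphism of the spaces intertwines them, up to an
isomorphism of the acting groups. -/
def AreIsomorphic {X₁ X₂ Γ₁ Γ₂ : Type*} [TopologicalSpace X₁] [TopologicalSpace X₂]
    [Group Γ₁] [Group Γ₂] (Φ₁ : Γ₁ →* (X₁ ≃ₜ X₁)) (Φ₂ : Γ₂ →* (X₂ ≃ₜ X₂)) : Prop :=
  ∃ (h : X₁ ≃ₜ X₂) (Θ : Γ₁ ≃* Γ₂), ∀ (g : Γ₁) (x : X₁), Φ₁ g x = h.symm (Φ₂ (Θ g) (h x))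

/-- Two actions of the same group are conjugate if a homeomorphism of the spaces is
equivariant. -/
def AreConjugate {X₁ X₂ Γ : Type*} [TopologicalSpace X₁] [TopologicalSpace X₂]
    [Group Γ] (Φ₁ : Γ →* (X₁ ≃ₜ X₁)) (Φ₂ : Γ →* (X₂ ≃ₜ X₂)) : Prop :=
  ∃ h : X₁ ≃ₜ X₂, ∀ (g : Γ) (x : X₁), Φ₁ g x = h.symm (Φ₂ g (h x))

/-- Two actions are return equivalent if the holonomy actions on some adapted sets are
isomorphic. -/
def AreReturnEquivalent {X₁ X₂ Γ₁ Γ₂ : Type*} [TopologicalSpace X₁] [TopologicalSpace X₂]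
    [Group Γ₁] [Group Γ₂] (Φ₁ : Γ₁ →* (X₁ ≃ₜ X₁)) (Φ₂ : Γ₂ →* (X₂ ≃ₜ X₂)) : Prop :=
  ∃ (U₁ : Set X₁) (hU₁ : IsAdapted Φ₁ U₁) (U₂ : Set X₂) (hU₂ : IsAdapted Φ₂ U₂),
    AreIsomorphic (holonomyAction Φ₁ U₁ hU₁) (holonomyAction Φ₂ U₂ hU₂)

/-- A Cantor action of `Γ`: a minimal equicontinuous action of `Γ` by homeomorphisms on a
Cantor space. -/
structure CantorAction (Γ : Type*) [Group Γ] where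
  /-- the space on which the group acts -/
  space : Type
  [top : TopologicalSpace space]
  [cantor : IsCantorSpace space]
  /-- the action -/
  act : Γ →* (space ≃ₜ space)
  minimal : IsMinimal act
  equicontinuous : IsEquicontinuous act

attribute [instance] CantorAction.top CantorAction.cantor

/-- A Cantor action of `Γ` is nilpotent if `Γ` has a finitely generated nilpotent subgroup of
finite index. -/
def CantorAction.IsNilpotent {Γ : Type*} [Group Γ] (_A : CantorAction Γ) : Prop :=
  ∃ N : Subgroup Γ, N.FiniteIndex ∧ Group.FG N ∧ Group.IsNilpotent N

end CantorDynamics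

/-! For an infinite set `P` of primes, let the Heisenberg group act by translations on the product
over `q ∈ P` of its reductions mod `q`. By the Chinese remainder theorem its image is dense, so this
is a Cantor action.

Return equivalence remembers `P` up to finite sets, through the isomorphism invariant `RotatesMod
p`. An adapted set contains a cylinder over finitely many coordinates; for every other `p ∈ P` some
return element has upper-left entry 1 mod `p`, and it rotates that entry
(`exists_finset_rotatesMod_holonomyAction`). Conversely, the reduction mod `q` has exponent dividing
`q ^ 2`, so a rotation mod `p` forces `p ∈ P` (`mem_of_rotates`).

It remains to choose uncountably many infinite sets of primes with pairwise infinite differences. -/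

namespace CantorDynamics

/-- Some element of the group acts, on a locally constant `ZMod p`-valued function, as the
translation by one. -/
def RotatesMod {X Γ : Type*} [TopologicalSpace X] [Group Γ] (p : ℕ) (Φ : Γ →* (X ≃ₜ X)) : Prop :=
  ∃ (g : Γ) (φ : X → ZMod p), IsLocallyConstant φ ∧ ∀ x, φ (Φ g x) = φ x + 1

theorem RotatesMod.of_areIsomorphic {X₁ X₂ Γ₁ Γ₂ : Type*} [TopologicalSpace X₁]
    [TopologicalSpace X₂] [Group Γ₁] [Group Γ₂] {Φ₁ : Γ₁ →* (X₁ ≃ₜ X₁)} {Φ₂ : Γ₂ →* (X₂ ≃ₜ X₂)}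
    {p : ℕ} (h₁ : RotatesMod p Φ₁) (h : AreIsomorphic Φ₁ Φ₂) : RotatesMod p Φ₂ := by
  obtain ⟨g, φ, hφ, hg⟩ := h₁
  obtain ⟨f, Θ, hf⟩ := h
  refine ⟨Θ g, φ ∘ f.symm, hφ.comp_continuous f.symm.continuous, fun y => ?_⟩
  have := hg (f.symm y)
  rw [hf] at this
  simpa using this

theorem AreConjugate.areIsomorphic {X₁ X₂ Γ : Type*} [TopologicalSpace X₁]
    [TopologicalSpace X₂] [Group Γ] {Φ₁ : Γ →* (X₁ ≃ₜ X₁)} {Φ₂ : Γ →* (X₂ ≃ₜ X₂)}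
    (h : AreConjugate Φ₁ Φ₂) : AreIsomorphic Φ₁ Φ₂ :=
  let ⟨f, hf⟩ := h
  ⟨f, MulEquiv.refl Γ, hf⟩

theorem AreConjugate.refl {X Γ : Type*} [TopologicalSpace X] [Group Γ] (Φ : Γ →* (X ≃ₜ X)) :
    AreConjugate Φ Φ :=
  ⟨Homeomorph.refl X, fun _ _ => rfl⟩

/-! ### Translation actions -/

/-- The action of a group on a topological group by left translations through a homomorphism. -/
def translationAction {Γ K : Type*} [Group Γ] [Group K] [TopologicalSpace K] [ContinuousMul K]
    (ρ : Γ →* K) : Γ →* (K ≃ₜ K) where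
  toFun g := Homeomorph.mulLeft (ρ g)
  map_one' := by ext x; simp
  map_mul' g g' := by ext x; simp [mul_assoc]

@[simp]
theorem translationAction_apply {Γ K : Type*} [Group Γ] [Group K] [TopologicalSpace K]
    [ContinuousMul K] (ρ : Γ →* K) (g : Γ) (x : K) : translationAction ρ g x = ρ g * x :=
  rfl

theorem isMinimal_translationAction {Γ K : Type*} [Group Γ] [Group K] [TopologicalSpace K]
    [IsTopologicalGroup K] {ρ : Γ →* K} (hρ : DenseRange ρ) : IsMinimal (translationAction ρ) :=
  fun x => (Homeomorph.mulRight x).surjective.denseRange.comp hρ (continuous_mul_const x)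

/-- Multiplication is uniformly continuous on the compact `K × K`, so one `δ` serves all left
factors. -/
theorem isEquicontinuous_translationAction {Γ K : Type*} [Group Γ] [Group K] [TopologicalSpace K]
    [ContinuousMul K] [CompactSpace K] [TopologicalSpace.MetrizableSpace K] (ρ : Γ →* K) :
    IsEquicontinuous (translationAction ρ) := by
  let m := TopologicalSpace.metrizableSpaceMetric K
  refine ⟨m, rfl, fun ε hε => ?_⟩
  have h : UniformContinuous fun z : K × K => z.1 * z.2 :=
    CompactSpace.uniformContinuous_of_continuous continuous_mul
  obtain ⟨δ, hδ, h⟩ := Metric.uniformContinuous_iff.1 h ε hε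
  refine ⟨δ, hδ, fun x y g hxy => h (a := (ρ g, x)) (b := (ρ g, y)) ?_⟩
  rw [Prod.dist_eq, dist_self]
  exact max_lt hδ hxy

/-! ### Products of discrete spaces -/

section Pi

variable {ι : Type*} {G : ι → Type*} [∀ i, TopologicalSpace (G i)]

theorem exists_finset_forall_eq_imp_mem {s : Set (∀ i, G i)} {x : ∀ i, G i} (hs : s ∈ nhds x) :
    ∃ F : Finset ι, ∀ y : ∀ i, G i, (∀ i ∈ F, y i = x i) → y ∈ s := by
  obtain ⟨t, hts, ht, hx⟩ := mem_nhds_iff.1 hs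
  obtain ⟨F, u, hu, hF⟩ := isOpen_pi_iff.1 ht x hx
  refine ⟨F, fun y hy => hts (hF fun i hi => ?_)⟩
  rw [hy i hi]
  exact (hu i hi).2

theorem isCantorSpace_pi [Countable ι] [Infinite ι] [∀ i, DiscreteTopology (G i)]
    [∀ i, Finite (G i)] [∀ i, Nontrivial (G i)] :
    IsCantorSpace (∀ i, G i) where
  nonempty := inferInstance
  compact := inferInstance
  metrizable := inferInstance
  totallyDisconnected := inferInstance
  perfect := by
    classical
    refine ⟨preperfect_iff_nhds.2 fun x _ s hs => ?_⟩
    obtain ⟨F, hF⟩ := exists_finset_forall_eq_imp_mem hs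
    obtain ⟨i, hi⟩ := Infinite.exists_notMem_finset F
    obtain ⟨a, ha⟩ := exists_ne (x i)
    refine ⟨Function.update x i a, ⟨hF _ fun j hj => ?_, trivial⟩, fun h => ha ?_⟩
    · exact Function.update_of_ne (ne_of_mem_of_not_mem hj hi) _ _
    · rw [← h, Function.update_self]

theorem denseRange_of_forall_finset {Γ : Type*} {ρ : Γ → ∀ i, G i}
    (hρ : ∀ (F : Finset ι) (x : ∀ i, G i), ∃ g, ∀ i ∈ F, ρ g i = x i) : DenseRange ρ := by
  intro x
  refine mem_closure_iff_nhds.2 fun s hs => ?_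
  obtain ⟨F, hF⟩ := exists_finset_forall_eq_imp_mem hs
  obtain ⟨g, hg⟩ := hρ F x
  exact ⟨ρ g, hF _ hg, g, rfl⟩

end Pi

end CantorDynamics

/-! ### The integer Heisenberg group -/

namespace heisenbergGroup

open Matrix

/-- The element of the Heisenberg group with the given entries above the diagonal. -/
def mk (a b c : ℤ) : heisenbergGroup :=
  ⟨⟨!![1, a, c; 0, 1, b; 0, 0, 1], !![1, -a, a * b - c; 0, 1, -b; 0, 0, 1], by
    ext i j
    fin_cases i <;> fin_cases j <;> simp [Matrix.mul_apply, Fin.sum_univ_three]; ring, by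
    ext i j
    fin_cases i <;> fin_cases j <;> simp [Matrix.mul_apply, Fin.sum_univ_three]; ring⟩,
    a, b, c, rfl⟩

theorem coe_mk (a b c : ℤ) :
    ((mk a b c : GL (Fin 3) ℤ) : Matrix (Fin 3) (Fin 3) ℤ) = !![1, a, c; 0, 1, b; 0, 0, 1] :=
  rfl

theorem exists_eq_mk (g : heisenbergGroup) : ∃ a b c : ℤ, g = mk a b c := by
  obtain ⟨a, b, c, h⟩ := g.2
  exact ⟨a, b, c, Subtype.ext (Units.ext h)⟩

theorem mk_mul_mk (a b c a' b' c' : ℤ) :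
    mk a b c * mk a' b' c' = mk (a + a') (b + b') (c + c' + a * b') := by
  refine Subtype.ext (Units.ext ?_)
  rw [Subgroup.coe_mul, Units.val_mul]
  simp only [coe_mk]
  ext i j
  fin_cases i <;> fin_cases j <;> simp [Matrix.mul_apply, Fin.sum_univ_three] <;> ring

theorem mk_zero : mk 0 0 0 = 1 := by
  refine Subtype.ext (Units.ext ?_)
  rw [coe_mk]
  ext i j
  fin_cases i <;> fin_cases j <;> simp

/-- The abelianization of the Heisenberg group. -/
def toIntProd : heisenbergGroup →* Multiplicative (ℤ × ℤ) where
  toFun g := Multiplicative.ofAdd ((g : GL (Fin 3) ℤ) 0 1, (g : GL (Fin 3) ℤ) 1 2)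
  map_one' := by simp
  map_mul' g g' := by
    obtain ⟨a, b, c, rfl⟩ := exists_eq_mk g
    obtain ⟨a', b', c', rfl⟩ := exists_eq_mk g'
    rw [mk_mul_mk]
    simp [coe_mk, ← ofAdd_add]

instance : Group.IsNilpotent heisenbergGroup := by
  refine Subgroup.isNilpotent_of_ker_le_center toIntProd fun g hg => ?_
  obtain ⟨a, b, c, rfl⟩ := exists_eq_mk g
  have h : (a, b) = ((0 : ℤ), (0 : ℤ)) := hg
  obtain ⟨rfl, rfl⟩ := Prod.mk.inj h
  refine Subgroup.mem_center_iff.2 fun g => ?_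
  obtain ⟨a', b', c', rfl⟩ := exists_eq_mk g
  simp [mk_mul_mk, add_comm]

theorem mk_zpow_left (n : ℤ) : mk 1 0 0 ^ n = mk n 0 0 := by
  induction n with
  | zero => rw [zpow_zero, mk_zero]
  | succ n ih => rw [_root_.zpow_add_one, ih, mk_mul_mk]; simp
  | pred n ih => rw [_root_.zpow_sub_one, ih, mul_inv_eq_iff_eq_mul, mk_mul_mk]; simp

theorem mk_zpow_right (n : ℤ) : mk 0 1 0 ^ n = mk 0 n 0 := by
  induction n with
  | zero => rw [zpow_zero, mk_zero]
  | succ n ih => rw [_root_.zpow_add_one, ih, mk_mul_mk]; simp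
  | pred n ih => rw [_root_.zpow_sub_one, ih, mul_inv_eq_iff_eq_mul, mk_mul_mk]; simp

theorem mk_zpow_center (n : ℤ) : mk 0 0 1 ^ n = mk 0 0 n := by
  induction n with
  | zero => rw [zpow_zero, mk_zero]
  | succ n ih => rw [_root_.zpow_add_one, ih, mk_mul_mk]; simp
  | pred n ih => rw [_root_.zpow_sub_one, ih, mul_inv_eq_iff_eq_mul, mk_mul_mk]; simp

instance : Group.FG heisenbergGroup := by
  refine Group.fg_iff.2 ⟨{mk 1 0 0, mk 0 1 0, mk 0 0 1}, ?_, by simp⟩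
  refine eq_top_iff.2 fun g _ => ?_
  obtain ⟨a, b, c, rfl⟩ := exists_eq_mk g
  have h : mk a b c = mk 0 0 1 ^ c * mk 0 1 0 ^ b * mk 1 0 0 ^ a := by
    simp [mk_zpow_left, mk_zpow_right, mk_zpow_center, mk_mul_mk]
  rw [h]
  refine mul_mem (mul_mem ?_ ?_) ?_ <;>
    exact zpow_mem (Subgroup.subset_closure (by simp)) _

end heisenbergGroup

theorem CantorDynamics.CantorAction.isNilpotent_of_heisenbergGroup
    (A : CantorDynamics.CantorAction heisenbergGroup) : A.IsNilpotent :=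
  ⟨⊤, inferInstance, (Group.fg_iff_subgroup_fg _).2 (Group.fg_def.1 inferInstance), inferInstance⟩

/-! ### Reduction modulo `q` -/

/-- The Heisenberg group over `ZMod q`: the image of the integer Heisenberg group. -/
def heisenbergGroupMod (q : ℕ) : Subgroup (Matrix.GeneralLinearGroup (Fin 3) (ZMod q)) :=
  heisenbergGroup.map (Matrix.GeneralLinearGroup.map (Int.castRingHom (ZMod q)))

namespace heisenbergGroupMod

open Matrix

instance (q : ℕ) : TopologicalSpace (heisenbergGroupMod q) := ⊥

instance (q : ℕ) : DiscreteTopology (heisenbergGroupMod q) := ⟨rfl⟩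

instance (q : ℕ) [NeZero q] : Finite (heisenbergGroupMod q) :=
  have : Finite (GL (Fin 3) (ZMod q)) := inferInstanceAs (Finite (Matrix _ _ _)ˣ)
  inferInstance

/-- The reduction of the integer Heisenberg group modulo `q`. -/
def reduction (q : ℕ) : heisenbergGroup →* heisenbergGroupMod q :=
  (Matrix.GeneralLinearGroup.map (Int.castRingHom (ZMod q))).subgroupMap heisenbergGroup

theorem reduction_surjective (q : ℕ) : Function.Surjective (reduction q) :=
  MonoidHom.subgroupMap_surjective _ _

theorem coe_reduction_mk (q : ℕ) (a b c : ℤ) :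
    ((reduction q (heisenbergGroup.mk a b c) : GL (Fin 3) (ZMod q)) :
      Matrix (Fin 3) (Fin 3) (ZMod q)) = !![1, (a : ZMod q), c; 0, 1, b; 0, 0, 1] := by
  ext i j
  change (((heisenbergGroup.mk a b c : GL (Fin 3) ℤ) i j : ℤ) : ZMod q) = _
  rw [heisenbergGroup.coe_mk]
  fin_cases i <;> fin_cases j <;> simp

theorem reduction_mk_eq {q : ℕ} {a b c a' b' c' : ℤ} (ha : (a : ZMod q) = a')
    (hb : (b : ZMod q) = b') (hc : (c : ZMod q) = c') :
    reduction q (heisenbergGroup.mk a b c) = reduction q (heisenbergGroup.mk a' b' c') := by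
  refine Subtype.ext (Units.ext ?_)
  rw [coe_reduction_mk, coe_reduction_mk, ha, hb, hc]

/-- The first entry above the diagonal. -/
def entry {q : ℕ} (x : heisenbergGroupMod q) : ZMod q :=
  (x : GL (Fin 3) (ZMod q)) 0 1

theorem entry_reduction_mk (q : ℕ) (a b c : ℤ) :
    entry (reduction q (heisenbergGroup.mk a b c)) = a := by
  rw [entry, coe_reduction_mk]
  simp

/-- The summands are swapped to match the form `φ x + 1` in `RotatesMod`. -/
theorem entry_mul {q : ℕ} (x y : heisenbergGroupMod q) : entry (x * y) = entry y + entry x := by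
  obtain ⟨g, rfl⟩ := reduction_surjective q x
  obtain ⟨g', rfl⟩ := reduction_surjective q y
  obtain ⟨a, b, c, rfl⟩ := heisenbergGroup.exists_eq_mk g
  obtain ⟨a', b', c', rfl⟩ := heisenbergGroup.exists_eq_mk g'
  rw [← map_mul, heisenbergGroup.mk_mul_mk]
  simp [entry_reduction_mk, add_comm]

instance (q : ℕ) [Fact q.Prime] : Nontrivial (heisenbergGroupMod q) := by
  refine ⟨reduction q (heisenbergGroup.mk 1 0 0), reduction q (heisenbergGroup.mk 0 0 0),
    fun h => ?_⟩
  simpa [entry_reduction_mk] using congrArg entry h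

/-- Write `x = 1 + N` with `N ^ 3 = 0`; Frobenius gives `x ^ q ^ 2 = 1 + N ^ q ^ 2`. The exponent
`q` would fail for `q = 2`, while `q ^ 2 ≥ 3` always. -/
theorem pow_sq_eq_one {q : ℕ} [hq : Fact q.Prime] (x : heisenbergGroupMod q) : x ^ q ^ 2 = 1 := by
  obtain ⟨g, rfl⟩ := reduction_surjective q x
  obtain ⟨a, b, c, rfl⟩ := heisenbergGroup.exists_eq_mk g
  refine Subtype.ext (Units.ext ?_)
  rw [Subgroup.coe_pow, Units.val_pow_eq_pow_val, coe_reduction_mk]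
  set N : Matrix (Fin 3) (Fin 3) (ZMod q) := !![0, (a : ZMod q), c; 0, 0, b; 0, 0, 0] with hN
  have h : !![1, (a : ZMod q), c; 0, 1, b; 0, 0, 1] = 1 + N := by
    ext i j
    fin_cases i <;> fin_cases j <;> simp [hN]
  have hN3 : N ^ 3 = 0 := by
    ext i j
    fin_cases i <;> fin_cases j <;> simp [hN, pow_succ, Matrix.mul_apply, Fin.sum_univ_three]
  have h3 : 3 ≤ q ^ 2 := by nlinarith [hq.out.two_le]
  rw [h, add_pow_char_pow_of_commute q 2 (Commute.one_left N), one_pow,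
    pow_eq_zero_of_le h3 hN3, add_zero]
  rfl

end heisenbergGroupMod

/-! ### The diagonal actions and their primes -/

namespace CantorDynamics

open heisenbergGroupMod

instance (q : Nat.Primes) : Fact (q : ℕ).Prime := ⟨q.2⟩

/-- The diagonal reduction of the Heisenberg group modulo all the primes in a set. -/
def diagonalReduction (P : Set Nat.Primes) :
    heisenbergGroup →* ∀ q : P, heisenbergGroupMod (q : Nat.Primes) :=
  MonoidHom.pi fun q => reduction (q : Nat.Primes)

theorem exists_intCast_eq (F : Finset Nat.Primes) (x : Nat.Primes → ℤ) :
    ∃ r : ℤ, ∀ q ∈ F, (r : ZMod (q : ℕ)) = x q := by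
  obtain ⟨r, hr⟩ := Ideal.exists_forall_sub_mem_ideal
    (I := fun q : F => Ideal.span {((q : Nat.Primes) : ℤ)}) (fun q q' h => by
      refine (Ideal.isCoprime_span_singleton_iff _ _).2 (Nat.isCoprime_iff_coprime.2 ?_)
      refine (Nat.coprime_primes q.1.2 q'.1.2).2 fun h' => h ?_
      exact Subtype.ext (Subtype.ext h')) fun q => x q
  refine ⟨r, fun q hq => ?_⟩
  have := Ideal.mem_span_singleton.1 (hr ⟨q, hq⟩)
  exact ((ZMod.intCast_eq_intCast_iff_dvd_sub _ _ _).2 this).symm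

theorem exists_diagonalReduction_eq {P : Set Nat.Primes} (F : Finset P)
    (x : ∀ q : P, heisenbergGroupMod (q : Nat.Primes)) :
    ∃ g, ∀ q ∈ F, diagonalReduction P g q = x q := by
  classical
  -- Integer lifts of the entries, extended by 0 to primes outside `P`.
  have h : ∀ q : Nat.Primes, ∃ a b c : ℤ, ∀ hq : q ∈ P,
      x ⟨q, hq⟩ = reduction q (heisenbergGroup.mk a b c) := fun q => by
    by_cases hq : q ∈ P
    · obtain ⟨g, hg⟩ := reduction_surjective _ (x ⟨q, hq⟩)
      obtain ⟨a, b, c, rfl⟩ := heisenbergGroup.exists_eq_mk g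
      exact ⟨a, b, c, fun _ => hg.symm⟩
    · exact ⟨0, 0, 0, fun h => absurd h hq⟩
  choose a b c h using h
  obtain ⟨r, hr⟩ := exists_intCast_eq (F.image (↑)) a
  obtain ⟨s, hs⟩ := exists_intCast_eq (F.image (↑)) b
  obtain ⟨t, ht⟩ := exists_intCast_eq (F.image (↑)) c
  refine ⟨heisenbergGroup.mk r s t, fun q hq => ?_⟩
  have hq' := Finset.mem_image_of_mem (↑· : P → Nat.Primes) hq
  rw [h q q.2]
  exact reduction_mk_eq (hr q hq') (hs q hq') (ht q hq')

/-- The action of the Heisenberg group by left translations on the product of the Heisenberg groups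
modulo the primes in a set. -/
def diagonalAction (P : Set Nat.Primes) :
    heisenbergGroup →* ((∀ q : P, heisenbergGroupMod (q : Nat.Primes)) ≃ₜ
      (∀ q : P, heisenbergGroupMod (q : Nat.Primes))) :=
  translationAction (diagonalReduction P)

theorem diagonalAction_apply {P : Set Nat.Primes} (g : heisenbergGroup)
    (x : ∀ q : P, heisenbergGroupMod (q : Nat.Primes)) :
    diagonalAction P g x = diagonalReduction P g * x :=
  rfl

/-- The Cantor action of the Heisenberg group by left translations on the product of the
Heisenberg groups modulo the primes in an infinite set. -/
def diagonalCantorAction (P : Set Nat.Primes) [Infinite P] : CantorAction heisenbergGroup where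
  space := ∀ q : P, heisenbergGroupMod (q : Nat.Primes)
  cantor := isCantorSpace_pi
  act := diagonalAction P
  minimal := isMinimal_translationAction (denseRange_of_forall_finset exists_diagonalReduction_eq)
  equicontinuous := isEquicontinuous_translationAction _

theorem rotatesMod_diagonalAction {P : Set Nat.Primes} {p : Nat.Primes} (hp : p ∈ P) :
    RotatesMod p (diagonalAction P) := by
  refine ⟨heisenbergGroup.mk 1 0 0, fun x => entry (x ⟨p, hp⟩),
    (IsLocallyConstant.of_discrete entry).comp_continuous
      (continuous_apply (⟨p, hp⟩ : P)), fun x => ?_⟩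
  have : entry (diagonalReduction P (heisenbergGroup.mk 1 0 0) ⟨p, hp⟩) = 1 :=
    (entry_reduction_mk p 1 0 0).trans Int.cast_one
  change entry (diagonalReduction P (heisenbergGroup.mk 1 0 0) ⟨p, hp⟩ * x ⟨p, hp⟩) = _
  rw [entry_mul, this]

/-- If some element of the group rotates a locally constant function on a nonempty set that is
open and invariant under this element, the modulus is one of the primes of the action. -/
theorem mem_of_rotates {P : Set Nat.Primes} {p : Nat.Primes}
    {U : Set (∀ q : P, heisenbergGroupMod (q : Nat.Primes))} (hU : U.Nonempty) (hUo : IsOpen U)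
    {φ : U → ZMod p} (hφ : IsLocallyConstant φ) {g : heisenbergGroup} {T : U → U}
    (hT : ∀ x, (T x : ∀ q : P, heisenbergGroupMod (q : Nat.Primes)) = diagonalAction P g x)
    (h : ∀ x, φ (T x) = φ x + 1) : p ∈ P := by
  obtain ⟨x, hx⟩ := hU
  have hs : Subtype.val '' {y : U | φ y = φ ⟨x, hx⟩} ∈ nhds x :=
    (hUo.isOpenMap_subtype_val _ (hφ.isOpen_fiber _)).mem_nhds ⟨⟨x, hx⟩, rfl, rfl⟩
  obtain ⟨F, hF⟩ := exists_finset_forall_eq_imp_mem hs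
  have hT' : ∀ n : ℕ, ((T^[n] ⟨x, hx⟩ : U) : ∀ q : P, heisenbergGroupMod (q : Nat.Primes)) =
      diagonalReduction P g ^ n * x := fun n => by
    induction n with
    | zero => simp
    | succ n ih => rw [Function.iterate_succ_apply', hT, ih, diagonalAction_apply, pow_succ',
        mul_assoc]
  have h' : ∀ n : ℕ, φ (T^[n] ⟨x, hx⟩) = φ ⟨x, hx⟩ + n := fun n => by
    induction n with
    | zero => simp
    | succ n ih => rw [Function.iterate_succ_apply', h, ih, Nat.cast_succ, add_assoc]
  -- The power `g ^ n` is trivial at every coordinate in `F`, so `T^[n]` preserves the value of `φ`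
  -- at `x`; but it also adds `n` to it. Hence `p` divides `n`.
  set n := ∏ q ∈ F, ((q : Nat.Primes) : ℕ) ^ 2 with hn
  obtain ⟨y, hy, hyx⟩ := hF (T^[n] ⟨x, hx⟩ : U) fun q hq => by
    obtain ⟨k, hk⟩ := Finset.dvd_prod_of_mem (fun q : P => ((q : Nat.Primes) : ℕ) ^ 2) hq
    have hq1 : diagonalReduction P g q ^ ((q : Nat.Primes) : ℕ) ^ 2 = 1 := pow_sq_eq_one _
    rw [hT', hn, hk, Pi.mul_apply, Pi.pow_apply, pow_mul, hq1, one_pow, one_mul]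
  rw [Subtype.ext hyx] at hy
  have hn0 : (n : ZMod p) = 0 := by simpa [h'] using hy
  obtain ⟨q, -, hpq⟩ := p.2.prime.exists_mem_finset_dvd ((ZMod.natCast_eq_zero_iff _ _).1 hn0)
  have : p = (q : Nat.Primes) :=
    Subtype.ext ((Nat.prime_dvd_prime_iff_eq p.2 q.1.2).1 (p.2.dvd_of_dvd_pow hpq))
  exact this ▸ q.2

theorem mem_of_rotatesMod_diagonalAction {P : Set Nat.Primes} {p : Nat.Primes}
    (h : RotatesMod p (diagonalAction P)) : p ∈ P := by
  obtain ⟨g, φ, hφ, h⟩ := h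
  exact mem_of_rotates (U := Set.univ) Set.univ_nonempty isOpen_univ
    (φ := fun x => φ x) (hφ.comp_continuous continuous_subtype_val) (g := g)
    (T := fun x => ⟨diagonalAction P g x, trivial⟩) (fun _ => rfl) fun x => h x

theorem mem_of_rotatesMod_holonomyAction {P : Set Nat.Primes} {p : Nat.Primes}
    {U : Set (∀ q : P, heisenbergGroupMod (q : Nat.Primes))} {hU : IsAdapted (diagonalAction P) U}
    (h : RotatesMod p (holonomyAction (diagonalAction P) U hU)) : p ∈ P := by
  obtain ⟨⟨_, g, rfl⟩, φ, hφ, h⟩ := h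
  exact mem_of_rotates hU.nonempty hU.isClopen.isOpen hφ (g := g)
    (T := restrictedAction (diagonalAction P) U hU g) (fun _ => rfl) h

theorem exists_finset_rotatesMod_holonomyAction {P : Set Nat.Primes}
    {U : Set (∀ q : P, heisenbergGroupMod (q : Nat.Primes))}
    (hU : IsAdapted (diagonalAction P) U) :
    ∃ F : Finset P, ∀ p : P, p ∉ F →
      RotatesMod (p : Nat.Primes) (holonomyAction (diagonalAction P) U hU) := by
  classical
  obtain ⟨x, hx⟩ := hU.nonempty
  obtain ⟨F, hF⟩ := exists_finset_forall_eq_imp_mem (hU.isClopen.isOpen.mem_nhds hx)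
  refine ⟨F, fun p hp => ?_⟩
  -- Being trivial on `F`, `g` keeps `x` in `U`; since `p ∉ F`, its coordinate at `p` is free.
  obtain ⟨g, hg⟩ := exists_diagonalReduction_eq (insert p F)
    (Function.update 1 p (reduction (p : Nat.Primes) (heisenbergGroup.mk 1 0 0)))
  have hgp : entry (diagonalReduction P g p) = 1 := by
    rw [hg p (Finset.mem_insert_self _ _), Function.update_self, entry_reduction_mk, Int.cast_one]
  have hgU : diagonalAction P g x ∈ U := hF _ fun q hq => by
    rw [diagonalAction_apply, Pi.mul_apply, hg q (Finset.mem_insert_of_mem hq),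
      Function.update_of_ne (ne_of_mem_of_not_mem hq hp), Pi.one_apply, one_mul]
  let g' : returnGroup (diagonalAction P) U hU := ⟨g, _, Set.mem_image_of_mem _ hx, hgU⟩
  refine ⟨⟨restrictedAction (diagonalAction P) U hU g', g', rfl⟩, fun y => entry (y.1 p),
    (IsLocallyConstant.of_discrete entry).comp_continuous
      ((continuous_apply p).comp continuous_subtype_val), fun y => ?_⟩
  change entry (diagonalReduction P g p * y.1 p) = _
  rw [entry_mul, hgp]

theorem finite_diff_of_areReturnEquivalent {P Q : Set Nat.Primes}
    (h : AreReturnEquivalent (diagonalAction P) (diagonalAction Q)) : (P \ Q).Finite := by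
  classical
  obtain ⟨U, hU, V, hV, h⟩ := h
  obtain ⟨F, hF⟩ := exists_finset_rotatesMod_holonomyAction hU
  refine (F.image ((↑) : P → Nat.Primes)).finite_toSet.subset fun p hp => ?_
  by_contra hpF
  refine hp.2 (mem_of_rotatesMod_holonomyAction ((hF ⟨p, hp.1⟩ fun h => hpF ?_).of_areIsomorphic h))
  exact Finset.mem_image_of_mem ((↑) : P → Nat.Primes) h

theorem subset_of_areIsomorphic {P Q : Set Nat.Primes}
    (h : AreIsomorphic (diagonalAction P) (diagonalAction Q)) : P ⊆ Q := fun _ hp =>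
  mem_of_rotatesMod_diagonalAction ((rotatesMod_diagonalAction hp).of_areIsomorphic h)

end CantorDynamics

/-! ### Almost disjoint sets and the conclusion -/

/-- In an infinite type, the subsets of `ℕ` index infinite sets that are pairwise almost
disjoint. -/
theorem exists_infinite_diff_infinite (α : Type*) [Infinite α] :
    ∃ P : Set ℕ → Set α, (∀ s, (P s).Infinite) ∧ ∀ s t, s ≠ t → (P s \ P t).Infinite := by
  classical
  let e : ℕ × Finset ℕ ↪ α := (Encodable.encode' (ℕ × Finset ℕ)).trans (Infinite.natEmbedding α)
  -- The code of `s` cut off at `n`; keeping `n` makes codes of different lengths distinct.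
  let c : Set ℕ → ℕ → ℕ × Finset ℕ := fun s n => (n, {i ∈ Finset.range n | i ∈ s})
  have hc : ∀ s, Function.Injective fun n => e (c s n) := fun s m n h =>
    congrArg Prod.fst (e.injective h)
  refine ⟨fun s => Set.range fun n => e (c s n), fun s => Set.infinite_range_of_injective (hc s),
    fun s t hst => ?_⟩
  obtain ⟨k, hk⟩ : ∃ k, ¬(k ∈ s ↔ k ∈ t) := by
    by_contra! h
    exact hst (Set.ext h)
  -- Codes of length greater than `k` record whether `k` belongs to the set, so those of `s` and `t`
  -- differ.
  refine Set.infinite_of_injective_forall_mem (f := fun n => e (c s (n + (k + 1))))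
    ((hc s).comp (add_left_injective (k + 1))) fun n => ⟨⟨_, rfl⟩, ?_⟩
  rintro ⟨m, hm⟩
  have hm := e.injective hm
  obtain rfl : m = n + (k + 1) := congrArg Prod.fst hm
  have := Finset.ext_iff.1 (congrArg Prod.snd hm) k
  simp only [c, Finset.mem_filter, Finset.mem_range] at this
  exact hk (by have : k < n + (k + 1) := by omega
               tauto)

theorem corollary1p4 :
    ∃ S : Set (CantorDynamics.CantorAction heisenbergGroup),
      ¬ S.Countable ∧
      (∀ A ∈ S, A.IsNilpotent) ∧
      (∀ A ∈ S, ∀ B ∈ S, A ≠ B →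
        ¬ CantorDynamics.AreReturnEquivalent A.act B.act ∧
        ¬ CantorDynamics.AreIsomorphic A.act B.act ∧
        ¬ CantorDynamics.AreConjugate A.act B.act) := by
  obtain ⟨P, hP, hPd⟩ := exists_infinite_diff_infinite Nat.Primes
  have hP' : ∀ s, Infinite (P s) := fun s => (hP s).to_subtype
  let A : Set ℕ → CantorDynamics.CantorAction heisenbergGroup := fun s =>
    CantorDynamics.diagonalCantorAction (P s)
  have hiso : ∀ s t, s ≠ t → ¬ CantorDynamics.AreIsomorphic (A s).act (A t).act := fun s t hst h =>
    hPd s t hst (by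
      rw [Set.sdiff_eq_empty.2 (CantorDynamics.subset_of_areIsomorphic h)]
      exact Set.finite_empty)
  have hA : Function.Injective A := fun s t hst => by
    by_contra hne
    refine hiso s t hne ?_
    rw [hst]
    exact (CantorDynamics.AreConjugate.refl _).areIsomorphic
  refine ⟨Set.range A, fun h => ?_, fun B _ => B.isNilpotent_of_heisenbergGroup, ?_⟩
  · have : Countable (Set ℕ) :=
      have := h.to_subtype
      Function.Injective.countable (f := Set.rangeFactorization A)
        fun s t hst => hA (congrArg Subtype.val hst)
    obtain ⟨f, hf⟩ := exists_surjective_nat (Set ℕ)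
    exact Function.cantor_surjective f hf
  · rintro _ ⟨s, rfl⟩ _ ⟨t, rfl⟩ hne
    have hst : s ≠ t := fun h => hne (congrArg A h)
    exact ⟨fun h => hPd s t hst (CantorDynamics.finite_diff_of_areReturnEquivalent h),
      hiso s t hst, fun h => hiso s t hst h.areIsomorphic⟩
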